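/- Let a task $\mathcal T_t$ have examples drawn i.i.d. from a probability distribution $\mathcal S_t$ on a measurable space $\mathcal Z$, and let $\mathcal L(\theta,z)\ge 0$ be the loss of the parameter $\theta\in\mathbb R^d$ on the example $z$, measurable in $z$. Write $R(\theta)=\mathbb E_{z\sim\mathcal S_t}\mathcal L(\theta,z)$ and $\hat R_{D}(\theta)=\frac1{n}\sum_{j=1}^{n}\mathcal L(\theta,z_j)$ for $D=(z_1,\dots,z_n)$, where $n=n^{tr}\ge 1$. Assume that $\theta\mapsto\mathcal L(\theta,z)$ is convex and differentiable with $\eta$-Lipschitz gradient for every $z$ ($\eta>0$). Let $\theta_{0t}=\sum_{k=1}^K\hat{\mathbf B}_k\theta_0$ with $\theta_0\in\mathbb R^d$ and $\hat{\mathbf B}_k\in\mathbb R^{d\times d}$, and assume $\mathcal L(\theta_{0t},z)\le M$ for every $z$. Given a training set $D=(z_1,\dots,z_n)$, the base learner runs SGD from $\theta_1=\theta_{0t}$ for $U\le n$ steps, $\theta_{u+1}=\theta_u-\alpha_u\nabla_\theta\mathcal L(\theta_u,z_{j_u})$, with $0\le\alpha_u\le c/\sqrt u$ for $1\le u\le U$,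 $0<c\le 1/\eta$, where the indices $(j_1,\dots,j_U)$ are drawn uniformly from $\{1,\dots,n\}$, either with replacement or without replacement, independently of $D$; let $A(D)=\theta_{U+1}$ be its output. Let $$\epsilon(\mathcal S_t,\theta_{0t})=\max_{1\le i\le n}\ \mathbb E_{D\sim\mathcal S_t^{n},\,z\sim\mathcal S_t}\,\mathbb E_{A}\big[\mathcal L(A(D),z)-\mathcal L(A(D^{(i)}),z)\big],$$ where $D^{(i)}$ is $D$ with its $i$-th example replaced by $z$; it is the least $\epsilon$ for which the base learner is $\epsilon$-on-average stable. Then the stability constant bounds the expected generalization gap, $$\mathbb E_{D\sim\mathcal S_t^{n}}\mathbb E_A\big[R(A(D))-\hat R_D(A(D))\big]\le\epsilon(\mathcal S_t,\theta_{0t}),$$ and there is a constant $C$ that depends only on $M$ such that, for every realization $D^{tr}\in\mathcal Z^{n}$ of the training set of the task, $$\epsilon(\mathcal S_t,\theta_{0t})\le C\sqrt{\hat R_{D^{tr}}(\theta_{0t})+\sqrt{1/n}}.$$ -/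

import Mathlib

open MeasureTheory

noncomputable section

namespace HSML

/-- The parameter space of the base learner. -/
abbrev Param (d : ℕ) : Type := EuclideanSpace ℝ (Fin d)

/-- The cluster-specific initialization `θ₀ₜ = ∑ₖ Bₖ θ₀`. -/
def clusterInit {d K : ℕ} (B : Fin K → Matrix (Fin d) (Fin d) ℝ) (θ₀ : Param d) : Param d :=
  ∑ k, Matrix.toEuclideanLin (B k) θ₀

section

variable {d : ℕ} {Z : Type*}

/-- Expected risk of the parameter `θ` under the example distribution `P`. -/
def risk [MeasurableSpace Z] (P : Measure Z) (ℓ : Param d → Z → ℝ) (θ : Param d) : ℝ :=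
  ∫ z, ℓ θ z ∂P

/-- Empirical risk of the parameter `θ` on the training set `S`. -/
def empiricalRisk {n : ℕ} (ℓ : Param d → Z → ℝ) (S : Fin n → Z) (θ : Param d) : ℝ :=
  (∑ j, ℓ θ (S j)) / n

/-- The output of stochastic gradient descent started at `θ` that processes the examples
`x 0, …, x (T - 1)` one after the other; the `u`-th update (`u = 1, …, T`) has step size `α u`. -/
def sgd (ℓ : Param d → Z → ℝ) (α : ℕ → ℝ) (θ : Param d) : (T : ℕ) → (Fin T → Z) → Param d
  | 0, _ => θ
  | T + 1, x =>
      sgd ℓ α θ T (fun u => x u.castSucc) -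
        α (T + 1) • gradient (fun w => ℓ w (x (Fin.last T)))
          (sgd ℓ α θ T (fun u => x u.castSucc))

/-- How SGD draws the indices of the training examples it visits. -/
inductive Sampling : Type
  | withReplacement : Sampling
  | withoutReplacement : Sampling

open Classical in
/-- The index sequences of length `T`, all equally likely, that SGD may use on `n` examples. -/
def indexSequences (n T : ℕ) : Sampling → Finset (Fin T → Fin n)
  | Sampling.withReplacement => Finset.univ
  | Sampling.withoutReplacement => Finset.univ.filter (fun I => Function.Injective I)

/-- Expectation of `g (A S)` over the random indices, where `A S` is the output of `T` steps of SGD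
on the training set `S`. -/
def sgdMean {n : ℕ} (s : Sampling) (ℓ : Param d → Z → ℝ) (α : ℕ → ℝ) (T : ℕ) (θ : Param d)
    (S : Fin n → Z) (g : Param d → ℝ) : ℝ :=
  (∑ I ∈ indexSequences n T s, g (sgd ℓ α θ T (fun u => S (I u)))) /
    ((indexSequences n T s).card : ℝ)

/-- `E_{S, z} E_A [ℓ (A S, z) - ℓ (A S⁽ⁱ⁾, z)]`, where `S ∼ Pⁿ` and `z ∼ P` are independent and
`S⁽ⁱ⁾` is `S` with its `i`-th example replaced by `z`. -/
def replaceOneGap [MeasurableSpace Z] (s : Sampling) (P : Measure Z) (ℓ : Param d → Z → ℝ)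
    (α : ℕ → ℝ) (n T : ℕ) (θ : Param d) (i : Fin n) : ℝ :=
  ∫ p : (Fin n → Z) × Z,
    (sgdMean s ℓ α T θ p.1 (fun w => ℓ w p.2) -
      sgdMean s ℓ α T θ (Function.update p.1 i p.2) (fun w => ℓ w p.2))
    ∂((Measure.pi fun _ : Fin n => P).prod P)

/-- SGD started at `θ` is `ε`-on-average stable for the example distribution `P`. -/
def IsOnAverageStable [MeasurableSpace Z] (s : Sampling) (P : Measure Z) (ℓ : Param d → Z → ℝ)
    (α : ℕ → ℝ) (n T : ℕ) (θ : Param d) (ε : ℝ) : Prop :=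
  ∀ i : Fin n, replaceOneGap s P ℓ α n T θ i ≤ ε

/-- The on-average stability constant `ε(P, θ)` of SGD started at `θ`. -/
def stabilityConstant [MeasurableSpace Z] (s : Sampling) (P : Measure Z) (ℓ : Param d → Z → ℝ)
    (α : ℕ → ℝ) (n T : ℕ) (θ : Param d) : ℝ :=
  ⨆ i : Fin n, replaceOneGap s P ℓ α n T θ i

/-- The stability constant is the least `ε` for which SGD is `ε`-on-average stable. -/
theorem isLeast_stabilityConstant [MeasurableSpace Z] (s : Sampling) (P : Measure Z)
    (ℓ : Param d → Z → ℝ) (α : ℕ → ℝ) (n T : ℕ) (hn : 1 ≤ n) (θ : Param d) :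
    IsLeast {ε : ℝ | IsOnAverageStable s P ℓ α n T θ ε} (stabilityConstant s P ℓ α n T θ) := by
  have : Nonempty (Fin n) := ⟨⟨0, hn⟩⟩
  exact ⟨fun i => le_ciSup (Set.finite_range _).bddAbove i, fun _ hε => ciSup_le hε⟩

/-- Expected generalization gap `E_S E_A [R (A S) - R̂_S (A S)]` of SGD started at `θ`. -/
def generalizationGap [MeasurableSpace Z] (s : Sampling) (P : Measure Z) (ℓ : Param d → Z → ℝ)
    (α : ℕ → ℝ) (n T : ℕ) (θ : Param d) : ℝ :=
  ∫ S : Fin n → Z, sgdMean s ℓ α T θ S (fun w => risk P ℓ w - empiricalRisk ℓ S w)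
    ∂(Measure.pi fun _ : Fin n => P)

end

end HSML

end

/-!
Everything probabilistic is a symmetry argument on top of pathwise estimates for SGD.

*Generalization gap.* Exchanging the `i`-th example of the sample with the fresh example preserves
the joint distribution (`measurePreserving_exchange`), so `replaceOneGap` at `i` is the expectation
of the risk minus the training loss at the `i`-th example. Averaging over `i` gives the
generalization gap (`generalizationGap_eq`), and an average is at most the maximum.

*Stability.* Let `β` be the Lipschitz constant of the gradients. Comparing the iterates with the
initialization, whose loss is at most `M`, yields an energy estimate that holds for every sequence of
examples (`energy_le`): after `T` steps of total size `A ≤ 2 √T / β`, both the squared distance from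
the initialization and `1 / (4 β)` times the weighted sum of the squared gradients used are at most
`4 M A`. Hence, as `T ≤ n`, the total length of the steps is `O(√(M n / β))`
(`sum_norm_visitedGradient_le`), while every gradient at the output is `O(√(β M √n))`
(`norm_gradient_sgd_le`). As gradient steps of convex smooth
functions are nonexpansive, two runs on samples that differ at `i` drift apart by at most the length
of the steps processing example `i` (`norm_sgd_sub_sgd_le`). By exchangeability this length has the
same expectation for all `i`, hence it is at most `1 / n` of the total length
(`integral_visitLength_le`). The product of gradient and drift is
`O(√(β M √n) √(M n / β) / n) = O(M n ^ (-1 / 4))`.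
This is at most a constant times `M √(R̂ + √(1 / n))` for every value `R̂ ≥ 0` of the
empirical risk, which is why the realization of the training set may be arbitrary.
-/

open MeasureTheory

noncomputable section

namespace HSML

/-! ### Convex functions with Lipschitz gradient -/

section ConvexSmooth

variable {E : Type*} [NormedAddCommGroup E] [InnerProductSpace ℝ E] [CompleteSpace E]

open scoped RealInnerProductSpace

/-- A convex differentiable real function on a Hilbert space whose gradient is `β`-Lipschitz. -/
structure IsConvexSmooth (β : ℝ) (f : E → ℝ) : Prop where
  convexOn : ConvexOn ℝ Set.univ f
  differentiable : Differentiable ℝ f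
  lipschitz : ∀ x y, ‖gradient f x - gradient f y‖ ≤ β * ‖x - y‖

variable {β : ℝ} {f : E → ℝ}

theorem hasDerivAt_comp_add_smul (hf : Differentiable ℝ f) (x v : E) (t : ℝ) :
    HasDerivAt (fun t : ℝ => f (x + t • v)) ⟪gradient f (x + t • v), v⟫ t := by
  have h1 : HasDerivAt (fun t : ℝ => x + t • v) v t := by
    simpa using ((hasDerivAt_id t).smul_const v).const_add x
  have h2 := (hf (x + t • v)).hasFDerivAt.comp_hasDerivAt t h1
  rwa [inner_gradient_left]

namespace IsConvexSmooth

/-- A convex function lies above its tangents. -/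
theorem tangent_le (hf : IsConvexSmooth β f) (x y : E) :
    f x + ⟪gradient f x, y - x⟫ ≤ f y := by
  have hc : ConvexOn ℝ Set.univ (fun t : ℝ => f (x + t • (y - x))) := by
    have e : (fun t : ℝ => f (x + t • (y - x))) = f ∘ AffineMap.lineMap (k := ℝ) x y := by
      ext t
      simp [AffineMap.lineMap_apply, add_comm]
    rw [e]
    exact hf.convexOn.comp_affineMap (AffineMap.lineMap (k := ℝ) x y)
  have hd := hasDerivAt_comp_add_smul hf.differentiable x (y - x) 0
  have := hc.le_slope_of_hasDerivAt (Set.mem_univ 0) (Set.mem_univ 1) one_pos hd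
  simp only [slope_def_field, zero_smul, add_zero, one_smul, add_sub_cancel, sub_zero,
    div_one] at this
  linarith

/-- The descent lemma: a function with `β`-Lipschitz gradient lies below a quadratic. -/
theorem le_quadratic (hf : IsConvexSmooth β f) (x y : E) :
    f y ≤ f x + ⟪gradient f x, y - x⟫ + β / 2 * ‖y - x‖ ^ 2 := by
  set v := y - x with hv
  let ψ : ℝ → ℝ := fun t => f (x + t • v) - (t * ⟪gradient f x, v⟫ + β / 2 * t ^ 2 * ‖v‖ ^ 2)
  have hd : ∀ t, HasDerivAt ψ
      (⟪gradient f (x + t • v), v⟫ - (⟪gradient f x, v⟫ + β * t * ‖v‖ ^ 2)) t := by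
    intro t
    refine (hasDerivAt_comp_add_smul hf.differentiable x v t).sub ?_
    have h1 := (hasDerivAt_id t).mul_const ⟪gradient f x, v⟫
    have h2 := (((hasDerivAt_id t).pow 2).const_mul (β / 2)).mul_const (‖v‖ ^ 2)
    refine (h1.add h2).congr_deriv ?_
    simp only [id_eq, Nat.cast_ofNat, Nat.add_one_sub_one, pow_one]
    ring
  have hanti : AntitoneOn ψ (Set.Icc 0 1) := by
    refine antitoneOn_of_deriv_nonpos (convex_Icc 0 1)
      (fun t _ => (hd t).continuousAt.continuousWithinAt)
      (fun t _ => (hd t).differentiableAt.differentiableWithinAt) fun t ht => ?_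
    rw [interior_Icc] at ht
    rw [(hd t).deriv]
    have h1 : ⟪gradient f (x + t • v) - gradient f x, v⟫ ≤ β * t * ‖v‖ ^ 2 := by
      calc _ ≤ ‖gradient f (x + t • v) - gradient f x‖ * ‖v‖ := real_inner_le_norm _ _
        _ ≤ (β * ‖x + t • v - x‖) * ‖v‖ := by gcongr; exact hf.lipschitz _ _
        _ = _ := by
          rw [add_sub_cancel_left, norm_smul, Real.norm_of_nonneg ht.1.le]; ring
    rw [inner_sub_left] at h1
    linarith
  have h := hanti (by simp) (by simp) (zero_le_one' ℝ)
  simp only [ψ, one_smul, zero_smul, add_zero] at h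
  rw [show x + v = y by simp [hv]] at h
  linarith

/-- Minimizing the quadratic upper bound at `y` of the function minus its tangent at `x`
sharpens the tangent inequality by the squared difference of the gradients. -/
theorem tangent_add_sq_le (hf : IsConvexSmooth β f) (hβ : 0 < β) (x y : E) :
    f x + ⟪gradient f x, y - x⟫ + ‖gradient f y - gradient f x‖ ^ 2 / (2 * β) ≤ f y := by
  set g := gradient f y - gradient f x with hg
  have h1 := hf.tangent_le x (y - (1 / β) • g)
  have h2 := hf.le_quadratic y (y - (1 / β) • g)
  have e1 : y - (1 / β) • g - x = (y - x) - (1 / β) • g := by abel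
  have e2 : y - (1 / β) • g - y = -((1 / β) • g) := by abel
  have e3 : ⟪gradient f y, g⟫ - ⟪gradient f x, g⟫ = ‖g‖ ^ 2 := by
    rw [← inner_sub_left, ← hg, real_inner_self_eq_norm_sq]
  rw [e1, inner_sub_right, inner_smul_right] at h1
  rw [e2, inner_neg_right, inner_smul_right, norm_neg, norm_smul, Real.norm_of_nonneg
    (by positivity)] at h2
  have e4 : 1 / β * ⟪gradient f y, g⟫ = 1 / β * ⟪gradient f x, g⟫ + 1 / β * ‖g‖ ^ 2 := by
    rw [← e3]; ring
  have e5 : β / 2 * (1 / β * ‖g‖) ^ 2 = ‖g‖ ^ 2 / (2 * β) := by field_simp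
  have e6 : 1 / β * ‖g‖ ^ 2 = 2 * (‖g‖ ^ 2 / (2 * β)) := by field_simp
  linarith

/-- The self-bounding property of a nonnegative smooth function. -/
theorem norm_gradient_sq_le (hf : IsConvexSmooth β f) (hβ : 0 < β) (h0 : ∀ x, 0 ≤ f x) (x : E) :
    ‖gradient f x‖ ^ 2 ≤ 2 * β * f x := by
  set g := gradient f x with hg
  have h2 := hf.le_quadratic x (x - (1 / β) • g)
  have e2 : x - (1 / β) • g - x = -((1 / β) • g) := by abel
  rw [e2, inner_neg_right, inner_smul_right, norm_neg, norm_smul, Real.norm_of_nonneg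
    (by positivity), ← hg, real_inner_self_eq_norm_sq] at h2
  have h3 := h0 (x - (1 / β) • g)
  have e5 : β / 2 * (1 / β * ‖g‖) ^ 2 = ‖g‖ ^ 2 / (2 * β) := by field_simp
  have e6 : 1 / β * ‖g‖ ^ 2 = 2 * (‖g‖ ^ 2 / (2 * β)) := by field_simp
  have h4 : ‖g‖ ^ 2 / (2 * β) ≤ f x := by linarith
  rw [div_le_iff₀ (by positivity)] at h4
  linarith

/-- The gradient of a convex smooth function is co-coercive. -/
theorem norm_gradient_sub_sq_le (hf : IsConvexSmooth β f) (hβ : 0 < β) (x y : E) :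
    ‖gradient f x - gradient f y‖ ^ 2 ≤ β * ⟪gradient f x - gradient f y, x - y⟫ := by
  have h1 := hf.tangent_add_sq_le hβ x y
  have h2 := hf.tangent_add_sq_le hβ y x
  rw [norm_sub_rev, ← neg_sub x y, inner_neg_right] at h1
  have h3 : ‖gradient f x - gradient f y‖ ^ 2 / (2 * β) * 2 ≤
      ⟪gradient f x - gradient f y, x - y⟫ := by
    rw [inner_sub_left]; linarith
  calc _ = β * (‖gradient f x - gradient f y‖ ^ 2 / (2 * β) * 2) := by field_simp
    _ ≤ _ := by gcongr

/-- A gradient step of length at most `1 / β` is nonexpansive. -/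
theorem norm_gradient_step_sub_le (hf : IsConvexSmooth β f) (hβ : 0 < β) {a : ℝ} (ha : 0 ≤ a)
    (ha' : a * β ≤ 1) (x y : E) :
    ‖(x - a • gradient f x) - (y - a • gradient f y)‖ ≤ ‖x - y‖ := by
  have h := hf.norm_gradient_sub_sq_le hβ x y
  set g := gradient f x - gradient f y with hg
  have e : (x - a • gradient f x) - (y - a • gradient f y) = (x - y) - a • g := by
    rw [hg, smul_sub]; abel
  rw [e]
  refine le_of_sq_le_sq ?_ (norm_nonneg _)
  rw [norm_sub_sq_real, inner_smul_right, norm_smul, Real.norm_of_nonneg ha,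
    real_inner_comm]
  have hp : 0 ≤ ⟪g, x - y⟫ := by
    by_contra hn
    nlinarith [sq_nonneg ‖g‖]
  have : a ^ 2 * ‖g‖ ^ 2 ≤ a * ⟪g, x - y⟫ := by
    calc a ^ 2 * ‖g‖ ^ 2 ≤ a ^ 2 * (β * ⟪g, x - y⟫) := by gcongr
      _ = (a * β) * (a * ⟪g, x - y⟫) := by ring
      _ ≤ 1 * (a * ⟪g, x - y⟫) := by gcongr
      _ = _ := one_mul _
  have h0 : 0 ≤ a * ⟪g, x - y⟫ := by positivity
  nlinarith

end IsConvexSmooth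

end ConvexSmooth

/-! ### Pathwise bounds on the trajectory of SGD -/

section Trajectory

open scoped RealInnerProductSpace

variable {d : ℕ} {Z : Type*} {ℓ : Param d → Z → ℝ} {α : ℕ → ℝ} {θ : Param d} {β M : ℝ}

/-- The gradient that SGD, started at `θ` and processing the examples `x`, evaluates in step
`u + 1`, at the iterate reached after `u` steps. -/
def visitedGradient (ℓ : Param d → Z → ℝ) (α : ℕ → ℝ) (θ : Param d) {T : ℕ} (x : Fin T → Z)
    (u : Fin T) : Param d :=
  gradient (fun w => ℓ w (x u)) (sgd ℓ α θ u (fun v => x (v.castLE u.isLt.le)))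

theorem visitedGradient_castSucc {T : ℕ} (x : Fin (T + 1) → Z) (u : Fin T) :
    visitedGradient ℓ α θ x u.castSucc = visitedGradient ℓ α θ (fun v => x v.castSucc) u :=
  rfl

theorem sgd_succ {T : ℕ} (x : Fin (T + 1) → Z) :
    sgd ℓ α θ (T + 1) x = sgd ℓ α θ T (fun u => x u.castSucc) -
      α (T + 1) • visitedGradient ℓ α θ x (Fin.last T) :=
  rfl

/-- Step sizes `0 ≤ α u ≤ 1 / (β √u)` for the first `T` steps. -/
def IsStepSize (β : ℝ) (α : ℕ → ℝ) (T : ℕ) : Prop :=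
  ∀ u < T, 0 ≤ α (u + 1) ∧ β * α (u + 1) ≤ 1 / √((u + 1 : ℕ) : ℝ)

theorem IsStepSize.of_succ {T : ℕ} (h : IsStepSize β α (T + 1)) : IsStepSize β α T :=
  fun u hu => h u (hu.trans T.lt_succ_self)

theorem IsStepSize.le_one {T : ℕ} (h : IsStepSize β α T) {u : ℕ} (hu : u < T) :
    α (u + 1) * β ≤ 1 := by
  rw [mul_comm]
  refine (h u hu).2.trans ?_
  rw [div_le_one (by positivity), Real.one_le_sqrt]
  exact_mod_cast Nat.le_add_left 1 u

/-- The total step size is at most `2 √T / β`. -/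
theorem IsStepSize.mul_sum_le {T : ℕ} (h : IsStepSize β α T) :
    β * ∑ u : Fin T, α (u + 1) ≤ 2 * √(T : ℝ) := by
  induction T with
  | zero => simp
  | succ T ih =>
    rw [Fin.sum_univ_castSucc, mul_add]
    have h1 := ih h.of_succ
    have h2 := (h T T.lt_succ_self).2
    have hs : 0 < √((T + 1 : ℕ) : ℝ) := by positivity
    have h3 : 1 / √((T + 1 : ℕ) : ℝ) ≤ 2 * √((T + 1 : ℕ) : ℝ) - 2 * √(T : ℝ) := by
      rw [div_le_iff₀ hs]
      have e1 : √((T + 1 : ℕ) : ℝ) ^ 2 = T + 1 := by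
        rw [Real.sq_sqrt (by positivity)]; push_cast; ring
      have e2 : √(T : ℝ) ^ 2 = T := Real.sq_sqrt (by positivity)
      nlinarith [sq_nonneg (√((T + 1 : ℕ) : ℝ) - √(T : ℝ))]
    simp only [Fin.val_castSucc, Fin.val_last]
    linarith

theorem IsStepSize.sum_nonneg {T : ℕ} (h : IsStepSize β α T) : 0 ≤ ∑ u : Fin T, α (u + 1) :=
  Finset.sum_nonneg fun u _ => (h u u.isLt).1

/-- The energy estimate for SGD, obtained by comparing the iterates with the initialization
itself: it controls the distance travelled and the weighted sum of the squared gradients at once. -/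
theorem energy_le (hβ : 0 < β) (hs : ∀ z, IsConvexSmooth β (fun w => ℓ w z))
    (h0 : ∀ w z, 0 ≤ ℓ w z) (hM : ∀ z, ℓ θ z ≤ M) {T : ℕ} (hα : IsStepSize β α T)
    (x : Fin T → Z) :
    ‖sgd ℓ α θ T x - θ‖ ^ 2 +
        1 / (4 * β) * ∑ u : Fin T, α (u + 1) * ‖visitedGradient ℓ α θ x u‖ ^ 2 ≤
      4 * M * ∑ u : Fin T, α (u + 1) := by
  induction T with
  | zero => simp [sgd]
  | succ T ih =>
    have ih := ih hα.of_succ (fun u => x u.castSucc)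
    rw [Fin.sum_univ_castSucc, Fin.sum_univ_castSucc, sgd_succ]
    simp only [visitedGradient_castSucc, Fin.val_castSucc, Fin.val_last]
    set w := sgd ℓ α θ T (fun u => x u.castSucc)
    set g := visitedGradient ℓ α θ x (Fin.last T) with hg
    have hgw : g = gradient (fun w => ℓ w (x (Fin.last T))) w := rfl
    obtain ⟨ha, ha'⟩ := hα T T.lt_succ_self
    have hle := hα.le_one T.lt_succ_self
    set a := α (T + 1)
    have hMz := hM (x (Fin.last T))
    have hM0 : 0 ≤ M := (h0 _ _).trans hMz
    have hself := (hs (x (Fin.last T))).norm_gradient_sq_le hβ (fun w => h0 w _) w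
    have htan := (hs (x (Fin.last T))).tangent_le w θ
    rw [← hgw] at hself htan
    have e1 : w - a • g - θ = (w - θ) - a • g := by abel
    have e2 : θ - w = -(w - θ) := by abel
    rw [e2, inner_neg_right] at htan
    rw [e1, norm_sub_sq_real, inner_smul_right, norm_smul, Real.norm_of_nonneg ha, real_inner_comm]
    have hG : 0 ≤ ‖g‖ ^ 2 := by positivity
    set G := ‖g‖ ^ 2
    have key : -2 * (a * ⟪g, w - θ⟫) + a ^ 2 * G + 1 / (4 * β) * (a * G) ≤ 4 * M * a := by
      have hGb : G / β ≤ 2 * ℓ w (x (Fin.last T)) := by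
        rw [div_le_iff₀ hβ]; linarith
      have e4 : 1 / (4 * β) * (a * G) = a * (1 / 4 * (G / β)) := by field_simp
      have e5 : a ^ 2 * G = a * ((a * β) * (G / β)) := by field_simp
      have hGb0 : 0 ≤ G / β := by positivity
      rw [e4, e5]
      -- The first step may have `a β = 1`, which leaves no decrease to spend; there the loss is
      -- at most `M`. From the second step on `a β ≤ 1 / √2 < 3 / 4`.
      rcases Nat.eq_zero_or_pos T with rfl | hT
      · have hwθ : w = θ := rfl
        rw [hwθ, sub_self, inner_zero_right]
        rw [hwθ] at hGb
        have : (a * β) * (G / β) ≤ 1 * (G / β) := by gcongr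
        have : a * ((a * β) * (G / β)) + a * (1 / 4 * (G / β)) ≤ a * (4 * M) := by
          rw [← mul_add]
          gcongr
          linarith
        linarith
      · have h34 : a * β ≤ 3 / 4 := by
          rw [mul_comm]
          refine ha'.trans ?_
          have h43 : (4 / 3 : ℝ) ≤ √((T + 1 : ℕ) : ℝ) := by
            refine Real.le_sqrt_of_sq_le ?_
            have : (1 : ℝ) ≤ T := by exact_mod_cast hT
            push_cast
            linarith
          rw [div_le_iff₀ (by positivity)]
          linarith
        have h5 : (a * β) * (G / β) ≤ 3 / 4 * (G / β) := by gcongr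
        have : a * (-2 * ⟪g, w - θ⟫ + (a * β) * (G / β) + 1 / 4 * (G / β)) ≤ a * (4 * M) := by
          gcongr
          linarith
        linarith
    have e6 : (a * ‖g‖) ^ 2 = a ^ 2 * G := by rw [mul_pow]
    rw [e6]
    linarith

/-- Cauchy–Schwarz and the energy estimate bound the total length of the SGD steps. -/
theorem sum_norm_visitedGradient_le (hβ : 0 < β) (hs : ∀ z, IsConvexSmooth β (fun w => ℓ w z))
    (h0 : ∀ w z, 0 ≤ ℓ w z) (hM : ∀ z, ℓ θ z ≤ M) {n T : ℕ} (hα : IsStepSize β α T) (hTn : T ≤ n)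
    (hM0 : 0 ≤ M) (x : Fin T → Z) :
    ∑ u : Fin T, α (u + 1) * ‖visitedGradient ℓ α θ x u‖ ≤ √(64 * M * n / β) := by
  refine Real.le_sqrt_of_sq_le ?_
  have hE := energy_le hβ hs h0 hM hα x
  have hA := hα.mul_sum_le
  have hA0 := hα.sum_nonneg
  set A := ∑ u : Fin T, α (u + 1)
  set Q := ∑ u : Fin T, α (u + 1) * ‖visitedGradient ℓ α θ x u‖ ^ 2
  have hCS : (∑ u : Fin T, α (u + 1) * ‖visitedGradient ℓ α θ x u‖) ^ 2 ≤ A * Q := by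
    refine Finset.sum_sq_le_sum_mul_sum_of_sq_le_mul _ (fun u _ => (hα u u.isLt).1)
      (fun u _ => mul_nonneg (hα u u.isLt).1 (sq_nonneg _)) fun u _ => (by ring : _ = _).le
  have hQ : Q ≤ 16 * β * M * A := by
    have h1 : 1 / (4 * β) * Q ≤ 4 * M * A := le_trans (le_add_of_nonneg_left (sq_nonneg _)) hE
    rw [one_div, inv_mul_le_iff₀ (by positivity)] at h1
    linarith
  have hA2 : (β * A) ^ 2 ≤ 4 * n := by
    calc (β * A) ^ 2 ≤ (2 * √(T : ℝ)) ^ 2 := by gcongr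
      _ = 4 * (T : ℝ) := by rw [mul_pow, Real.sq_sqrt (by positivity)]; norm_num
      _ ≤ 4 * (n : ℝ) := by gcongr
  calc _ ≤ A * Q := hCS
    _ ≤ A * (16 * β * M * A) := by gcongr
    _ = 16 * M / β * (β * A) ^ 2 := by field_simp
    _ ≤ 16 * M / β * (4 * n) := by gcongr
    _ = _ := by ring

/-- The distance from the initialization grows at most like `T ^ (1 / 4)`, which bounds every
gradient at the output of SGD, visited or not. -/
theorem norm_gradient_sgd_le (hβ : 0 < β) (hs : ∀ z, IsConvexSmooth β (fun w => ℓ w z))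
    (h0 : ∀ w z, 0 ≤ ℓ w z) (hM : ∀ z, ℓ θ z ≤ M) {n T : ℕ} (hα : IsStepSize β α T) (hTn : T ≤ n)
    (hn : 1 ≤ n) (x : Fin T → Z) (z : Z) :
    ‖gradient (fun w => ℓ w z) (sgd ℓ α θ T x)‖ ≤ √(20 * β * M * √(n : ℝ)) := by
  have hM0 : 0 ≤ M := (h0 _ _).trans (hM z)
  refine Real.le_sqrt_of_sq_le ?_
  have hE := energy_le hβ hs h0 hM hα x
  have hA := hα.mul_sum_le
  set w := sgd ℓ α θ T x
  have hQ : 0 ≤ ∑ u : Fin T, α (u + 1) * ‖visitedGradient ℓ α θ x u‖ ^ 2 :=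
    Finset.sum_nonneg fun u _ => mul_nonneg (hα u u.isLt).1 (sq_nonneg _)
  set A := ∑ u : Fin T, α (u + 1)
  have hD : ‖w - θ‖ ^ 2 ≤ 4 * M * A :=
    le_trans (le_add_of_nonneg_right (by positivity)) hE
  have hself := (hs z).norm_gradient_sq_le hβ (fun w => h0 w z) θ
  have hlip := (hs z).lipschitz w θ
  set g₀ := gradient (fun w => ℓ w z) θ
  set g := gradient (fun w => ℓ w z) w
  have htri : ‖g‖ ≤ ‖g₀‖ + β * ‖w - θ‖ := by
    calc ‖g‖ = ‖g₀ + (g - g₀)‖ := by rw [add_sub_cancel]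
      _ ≤ ‖g₀‖ + ‖g - g₀‖ := norm_add_le _ _
      _ ≤ _ := by gcongr
  have hTn' : √(T : ℝ) ≤ √(n : ℝ) := by gcongr
  have h1n : 1 ≤ √(n : ℝ) := by rw [Real.one_le_sqrt]; exact_mod_cast hn
  calc ‖g‖ ^ 2 ≤ (‖g₀‖ + β * ‖w - θ‖) ^ 2 := by gcongr
    _ ≤ 2 * (‖g₀‖ ^ 2 + (β * ‖w - θ‖) ^ 2) := add_sq_le
    _ = 2 * (‖g₀‖ ^ 2 + β ^ 2 * ‖w - θ‖ ^ 2) := by ring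
    _ ≤ 2 * (2 * β * M * √(n : ℝ) + β ^ 2 * (4 * M * A)) := by
      have h2 : 2 * β * ℓ θ z ≤ 2 * β * M * √(n : ℝ) := by
        calc 2 * β * ℓ θ z ≤ 2 * β * M := by gcongr; exact hM z
          _ ≤ _ := le_mul_of_one_le_right (by positivity) h1n
      gcongr
      exact hself.trans h2
    _ = 4 * β * M * √(n : ℝ) + 8 * β * M * (β * A) := by ring
    _ ≤ 4 * β * M * √(n : ℝ) + 8 * β * M * (2 * √(n : ℝ)) := by
      gcongr _ + _ * ?_
      linarith
    _ = _ := by ring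

theorem exists_loss_sgd_le (hβ : 0 < β) (hs : ∀ z, IsConvexSmooth β (fun w => ℓ w z))
    (h0 : ∀ w z, 0 ≤ ℓ w z) (hM : ∀ z, ℓ θ z ≤ M) {T : ℕ} (hα : IsStepSize β α T) :
    ∃ L, 0 ≤ L ∧ ∀ (x : Fin T → Z) (z : Z), ℓ (sgd ℓ α θ T x) z ≤ L := by
  set G := √(20 * β * M * √((T + 1 : ℕ) : ℝ))
  set D := √(4 * M * ∑ u : Fin T, α (u + 1))
  refine ⟨|M| + G * D, by positivity, fun x z => ?_⟩
  have hG := norm_gradient_sgd_le hβ hs h0 hM hα T.le_succ (Nat.le_add_left 1 T) x z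
  have hD : ‖θ - sgd ℓ α θ T x‖ ≤ D := by
    rw [norm_sub_rev]
    refine Real.le_sqrt_of_sq_le (le_trans (le_add_of_nonneg_right ?_) (energy_le hβ hs h0 hM hα x))
    exact mul_nonneg (by positivity)
      (Finset.sum_nonneg fun u _ => mul_nonneg (hα u u.isLt).1 (sq_nonneg _))
  have htan := (hs z).tangent_le (sgd ℓ α θ T x) θ
  have hin := neg_le_of_abs_le (abs_real_inner_le_norm (gradient (fun w => ℓ w z) (sgd ℓ α θ T x))
    (θ - sgd ℓ α θ T x))
  have hmul : ‖gradient (fun w => ℓ w z) (sgd ℓ α θ T x)‖ * ‖θ - sgd ℓ α θ T x‖ ≤ G * D := by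
    gcongr
  linarith [hM z, le_abs_self M]

/-- Two runs of SGD drift apart only in the steps whose examples differ. -/
theorem norm_sgd_sub_sgd_le (hβ : 0 < β) (hs : ∀ z, IsConvexSmooth β (fun w => ℓ w z)) {T : ℕ}
    (hα : IsStepSize β α T) (x y : Fin T → Z) (p : Fin T → Prop) [DecidablePred p]
    (hp : ∀ u, ¬ p u → x u = y u) :
    ‖sgd ℓ α θ T x - sgd ℓ α θ T y‖ ≤
      ∑ u : Fin T, if p u then
        α (u + 1) * (‖visitedGradient ℓ α θ x u‖ + ‖visitedGradient ℓ α θ y u‖) else 0 := by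
  induction T with
  | zero => simp [sgd]
  | succ T ih =>
    have ih := ih hα.of_succ (fun u => x u.castSucc) (fun u => y u.castSucc)
      (fun u => p u.castSucc) (fun u hu => hp _ hu)
    rw [Fin.sum_univ_castSucc, sgd_succ, sgd_succ]
    simp only [visitedGradient_castSucc, Fin.val_castSucc, Fin.val_last]
    set w := sgd ℓ α θ T (fun u => x u.castSucc)
    set v := sgd ℓ α θ T (fun u => y u.castSucc)
    obtain ⟨ha, -⟩ := hα T T.lt_succ_self
    split_ifs with h
    · set g := visitedGradient ℓ α θ x (Fin.last T)
      set g' := visitedGradient ℓ α θ y (Fin.last T)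
      have e : w - α (T + 1) • g - (v - α (T + 1) • g') =
          (w - v) + (α (T + 1) • g' - α (T + 1) • g) := by abel
      calc _ ≤ ‖w - v‖ + (‖α (T + 1) • g'‖ + ‖α (T + 1) • g‖) := by
            rw [e]
            exact (norm_add_le _ _).trans (by gcongr; exact norm_sub_le _ _)
        _ = ‖w - v‖ + α (T + 1) * (‖g‖ + ‖g'‖) := by
            rw [norm_smul, norm_smul, Real.norm_of_nonneg ha]; ring
        _ ≤ _ := by gcongr
    · have hxy := hp _ h
      have e1 : visitedGradient ℓ α θ x (Fin.last T) =
          gradient (fun w => ℓ w (x (Fin.last T))) w := rfl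
      have e2 : visitedGradient ℓ α θ y (Fin.last T) =
          gradient (fun w => ℓ w (x (Fin.last T))) v := by rw [hxy]; rfl
      rw [e1, e2, add_zero]
      exact ((hs _).norm_gradient_step_sub_le hβ ha (hα.le_one T.lt_succ_self) _ _).trans ih

end Trajectory

/-! ### Measurability of SGD -/

section Measurability

open scoped RealInnerProductSpace
open Filter Topology

variable {d : ℕ} {Z : Type*} [MeasurableSpace Z] {ℓ : Param d → Z → ℝ} {α : ℕ → ℝ} {θ : Param d}
  {β M : ℝ}

theorem measurable_loss (hm : ∀ w, Measurable (ℓ w)) (hs : ∀ z, IsConvexSmooth β (fun w => ℓ w z)) :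
    Measurable fun p : Param d × Z => ℓ p.1 p.2 :=
  measurable_uncurry_of_continuous_of_measurable (fun z => (hs z).differentiable.continuous) hm

/-- At a fixed parameter the gradient is measurable in the example, being a limit of difference
quotients. -/
theorem measurable_gradient_apply (hm : ∀ w, Measurable (ℓ w))
    (hs : ∀ z, IsConvexSmooth β (fun w => ℓ w z)) (w : Param d) :
    Measurable fun z => gradient (fun v => ℓ v z) w := by
  have hdir : ∀ v : Param d, Measurable fun z => ⟪v, gradient (fun v => ℓ v z) w⟫ := by
    intro v
    refine measurable_of_tendsto_metrizable
      (f := fun (k : ℕ) z => (1 / ((k : ℝ) + 1))⁻¹ • (ℓ (w + (1 / ((k : ℝ) + 1)) • v) z - ℓ w z))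
      (fun k => ((hm _).sub (hm w)).const_mul _) ?_
    rw [tendsto_pi_nhds]
    intro z
    have hd := (hasDerivAt_comp_add_smul (hs z).differentiable w v 0).tendsto_slope_zero
    simp only [zero_add, zero_smul, add_zero] at hd
    rw [real_inner_comm]
    refine hd.comp (tendsto_nhdsWithin_iff.2 ⟨tendsto_one_div_add_atTop_nhds_zero_nat, ?_⟩)
    exact Eventually.of_forall fun k => (Nat.one_div_pos_of_nat (α := ℝ)).ne'
  have hsum : (fun z => gradient (fun v => ℓ v z) w) = fun z =>
      ∑ i, ⟪EuclideanSpace.basisFun (Fin d) ℝ i, gradient (fun v => ℓ v z) w⟫ •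
        EuclideanSpace.basisFun (Fin d) ℝ i := by
    ext1 z
    exact ((EuclideanSpace.basisFun (Fin d) ℝ).sum_repr' _).symm
  rw [hsum]
  exact Finset.measurable_sum _ fun i _ => (hdir _).smul_const _

theorem measurable_gradient (hm : ∀ w, Measurable (ℓ w))
    (hs : ∀ z, IsConvexSmooth β (fun w => ℓ w z)) :
    Measurable fun p : Param d × Z => gradient (fun v => ℓ v p.2) p.1 := by
  refine measurable_uncurry_of_continuous_of_measurable
    (u := fun w z => gradient (fun v => ℓ v z) w) (fun z => ?_) (measurable_gradient_apply hm hs)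
  refine (LipschitzWith.of_dist_le_mul (K := β.toNNReal) fun x y => ?_).continuous
  rw [dist_eq_norm, dist_eq_norm]
  refine ((hs z).lipschitz x y).trans ?_
  gcongr
  exact Real.le_coe_toNNReal β

theorem measurable_sgd (hm : ∀ w, Measurable (ℓ w))
    (hs : ∀ z, IsConvexSmooth β (fun w => ℓ w z)) (T : ℕ) :
    Measurable fun x : Fin T → Z => sgd ℓ α θ T x := by
  induction T with
  | zero => exact measurable_const
  | succ T ih =>
    have h1 : Measurable fun x : Fin (T + 1) → Z => sgd ℓ α θ T (fun u => x u.castSucc) :=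
      ih.comp (measurable_pi_lambda _ fun u => measurable_pi_apply _)
    have h2 := (measurable_gradient hm hs).comp (h1.prodMk (measurable_pi_apply (Fin.last T)))
    exact h1.sub (h2.const_smul (α (T + 1)))

theorem measurable_visitedGradient (hm : ∀ w, Measurable (ℓ w))
    (hs : ∀ z, IsConvexSmooth β (fun w => ℓ w z)) {T : ℕ} (u : Fin T) :
    Measurable fun x : Fin T → Z => visitedGradient ℓ α θ x u :=
  (measurable_gradient hm hs).comp
    (((measurable_sgd hm hs u).comp (measurable_pi_lambda _ fun _ => measurable_pi_apply _)).prodMk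
      (measurable_pi_apply u))

theorem measurable_loss_sgd (hm : ∀ w, Measurable (ℓ w))
    (hs : ∀ z, IsConvexSmooth β (fun w => ℓ w z)) {n T : ℕ} (I : Fin T → Fin n) :
    Measurable fun p : (Fin n → Z) × Z => ℓ (sgd ℓ α θ T (fun u => p.1 (I u))) p.2 := by
  have h1 : Measurable fun p : (Fin n → Z) × Z => sgd ℓ α θ T (fun u => p.1 (I u)) :=
    (measurable_sgd hm hs T).comp
      (measurable_pi_lambda _ fun u => (measurable_pi_apply _).comp measurable_fst)
  exact (measurable_loss hm hs).comp (h1.prodMk measurable_snd)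

end Measurability

/-! ### Symmetries of the sample -/

section Symmetry

variable {Z : Type*} [MeasurableSpace Z] (P : Measure Z) [IsProbabilityMeasure P]

/-- An i.i.d. sample is exchangeable. -/
theorem measurePreserving_comp_perm {ι : Type*} [Fintype ι] (σ : Equiv.Perm ι) :
    MeasurePreserving (fun S : ι → Z => fun j => S (σ j)) (Measure.pi fun _ => P)
      (Measure.pi fun _ => P) := by
  have h := measurePreserving_piCongrLeft (fun _ : ι => P) σ.symm
  convert h using 1
  ext S j
  have := MeasurableEquiv.piCongrLeft_apply_apply (β := fun _ : ι => Z) σ.symm S (σ j)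
  simpa using this.symm

/-- Exchanging the `i`-th example of an i.i.d. sample with a fresh example preserves the joint
distribution, since it is a transposition of `n + 1` i.i.d. examples. -/
theorem measurePreserving_exchange {n : ℕ} (i : Fin n) :
    MeasurePreserving (fun p : (Fin n → Z) × Z => (Function.update p.1 i p.2, p.1 i))
      ((Measure.pi fun _ => P).prod P) ((Measure.pi fun _ => P).prod P) := by
  let Φ : (Fin (n + 1) → Z) → (Fin n → Z) × Z := fun x => (fun j => x j.castSucc, x (Fin.last n))
  have hΦ : MeasurePreserving Φ (Measure.pi fun _ => P) ((Measure.pi fun _ => P).prod P) := by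
    have h := (Measure.measurePreserving_swap (μ := P) (ν := Measure.pi fun _ : Fin n => P)).comp
      (measurePreserving_piFinSuccAbove (fun _ : Fin (n + 1) => P) (Fin.last n))
    convert h using 1
    ext x j
    · simp [Φ, MeasurableEquiv.piFinSuccAbove, Fin.insertNthEquiv, Fin.init]
    · simp [Φ, MeasurableEquiv.piFinSuccAbove, Fin.insertNthEquiv]
  have hτ : Measurable fun p : (Fin n → Z) × Z => (Function.update p.1 i p.2, p.1 i) := by
    refine Measurable.prodMk ?_ ((measurable_pi_apply i).comp measurable_fst)
    refine measurable_pi_lambda _ fun j => ?_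
    by_cases h : j = i
    · subst h
      simpa using measurable_snd
    · simp only [Function.update_of_ne h]
      exact (measurable_pi_apply j).comp measurable_fst
  refine ⟨hτ, ?_⟩
  have hσ := hΦ.comp (measurePreserving_comp_perm P (Equiv.swap i.castSucc (Fin.last n)))
  conv_lhs => rw [← hΦ.map_eq]
  rw [Measure.map_map hτ hΦ.measurable, ← hσ.map_eq]
  congr 1
  ext x j
  · by_cases h : j = i
    · subst h
      simp [Φ]
    · have h1 : j.castSucc ≠ i.castSucc := fun e => h (Fin.castSucc_injective n e)
      simp [Φ, Function.update_of_ne h, Equiv.swap_apply_of_ne_of_ne h1 (Fin.castSucc_lt_last j).ne]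
  · simp [Φ]

end Symmetry

/-! ### Averages over the random indices -/

section SgdMean

variable {d : ℕ} {Z : Type*} {ℓ : Param d → Z → ℝ} {α : ℕ → ℝ} {θ : Param d} {n T : ℕ}
  {s : Sampling}

theorem comp_perm_mem_indexSequences {σ : Equiv.Perm (Fin n)} {I : Fin T → Fin n}
    (hI : I ∈ indexSequences n T s) : (fun u => σ (I u)) ∈ indexSequences n T s := by
  cases s with
  | withReplacement => simp [indexSequences]
  | withoutReplacement =>
    simp only [indexSequences, Finset.mem_filter, Finset.mem_univ, true_and] at hI ⊢
    exact σ.injective.comp hI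

theorem sum_div_card_le {ι : Type*} (F : Finset ι) {f : ι → ℝ} {c : ℝ} (hc : 0 ≤ c)
    (h : ∀ i ∈ F, f i ≤ c) : (∑ i ∈ F, f i) / (F.card : ℝ) ≤ c := by
  refine div_le_of_le_mul₀ (by positivity) hc ?_
  have := Finset.sum_le_card_nsmul F f c h
  rwa [nsmul_eq_mul, mul_comm] at this

theorem sgdMean_nonneg {S : Fin n → Z} {g : Param d → ℝ} (hg : ∀ w, 0 ≤ g w) :
    0 ≤ sgdMean s ℓ α T θ S g :=
  div_nonneg (Finset.sum_nonneg fun _ _ => hg _) (Nat.cast_nonneg _)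

theorem sgdMean_sub (S : Fin n → Z) (g h : Param d → ℝ) :
    sgdMean s ℓ α T θ S (fun w => g w - h w) =
      sgdMean s ℓ α T θ S g - sgdMean s ℓ α T θ S h := by
  simp only [sgdMean, Finset.sum_sub_distrib, sub_div]

theorem sgdMean_empiricalRisk (S : Fin n → Z) :
    sgdMean s ℓ α T θ S (empiricalRisk ℓ S) =
      (∑ j, sgdMean s ℓ α T θ S (fun w => ℓ w (S j))) / n := by
  simp only [sgdMean, empiricalRisk, ← Finset.sum_div]
  rw [Finset.sum_comm, div_right_comm]

/-- The expected length of the SGD steps that process the `i`-th training example. -/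
def visitLength (s : Sampling) (ℓ : Param d → Z → ℝ) (α : ℕ → ℝ) (T : ℕ) (θ : Param d)
    (S : Fin n → Z) (i : Fin n) : ℝ :=
  (∑ I ∈ indexSequences n T s, ∑ u : Fin T, if I u = i then
    α (u + 1) * ‖visitedGradient ℓ α θ (fun u => S (I u)) u‖ else 0) /
      ((indexSequences n T s).card : ℝ)

theorem visitLength_comp_perm (S : Fin n → Z) (σ : Equiv.Perm (Fin n)) (i : Fin n) :
    visitLength s ℓ α T θ (fun j => S (σ j)) i = visitLength s ℓ α T θ S (σ i) := by
  unfold visitLength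
  congr 1
  refine Finset.sum_nbij' (fun I u => σ (I u)) (fun I u => σ.symm (I u))
    (fun I hI => comp_perm_mem_indexSequences hI) (fun I hI => comp_perm_mem_indexSequences hI)
    (fun I _ => by simp) (fun I _ => by simp) fun I _ => ?_
  simp only [EmbeddingLike.apply_eq_iff_eq]

variable {β M : ℝ}

theorem visitLength_nonneg (hα : IsStepSize β α T) (S : Fin n → Z) (i : Fin n) :
    0 ≤ visitLength s ℓ α T θ S i := by
  refine div_nonneg (Finset.sum_nonneg fun I _ => Finset.sum_nonneg fun u _ => ?_)
    (Nat.cast_nonneg _)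
  split_ifs
  · exact mul_nonneg (hα u u.isLt).1 (norm_nonneg _)
  · exact le_rfl

theorem sum_visitLength_le (hβ : 0 < β) (hs : ∀ z, IsConvexSmooth β (fun w => ℓ w z))
    (h0 : ∀ w z, 0 ≤ ℓ w z) (hM : ∀ z, ℓ θ z ≤ M) (hM0 : 0 ≤ M) (hα : IsStepSize β α T)
    (hTn : T ≤ n) (S : Fin n → Z) :
    ∑ i, visitLength s ℓ α T θ S i ≤ √(64 * M * n / β) := by
  simp only [visitLength, ← Finset.sum_div]
  rw [Finset.sum_comm]
  refine sum_div_card_le _ (Real.sqrt_nonneg _) fun I _ => ?_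
  rw [Finset.sum_comm]
  simpa using sum_norm_visitedGradient_le hβ hs h0 hM hα hTn hM0 (fun u => S (I u))

/-- Replacing one example changes the loss of the output by at most the largest gradient at the
output times the length of the steps processing that example in the two runs. -/
theorem sgdMean_sub_update_le (hβ : 0 < β) (hs : ∀ z, IsConvexSmooth β (fun w => ℓ w z))
    (h0 : ∀ w z, 0 ≤ ℓ w z) (hM : ∀ z, ℓ θ z ≤ M) (hα : IsStepSize β α T) (hTn : T ≤ n)
    (hn : 1 ≤ n) (S : Fin n → Z) (i : Fin n) (z : Z) :
    sgdMean s ℓ α T θ S (fun w => ℓ w z) -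
        sgdMean s ℓ α T θ (Function.update S i z) (fun w => ℓ w z) ≤
      √(20 * β * M * √(n : ℝ)) *
        (visitLength s ℓ α T θ S i + visitLength s ℓ α T θ (Function.update S i z) i) := by
  unfold sgdMean visitLength
  rw [← sub_div, ← Finset.sum_sub_distrib, ← add_div, ← Finset.sum_add_distrib, mul_div_assoc',
    Finset.mul_sum]
  gcongr with I hI
  set S' := Function.update S i z with hS'
  set w := sgd ℓ α θ T (fun u => S (I u))
  set w' := sgd ℓ α θ T (fun u => S' (I u))
  have htan := (hs z).tangent_le w w'
  have hin := neg_le_of_abs_le (abs_real_inner_le_norm (gradient (fun w => ℓ w z) w) (w' - w))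
  have hstab := norm_sgd_sub_sgd_le (θ := θ) hβ hs hα (fun u => S (I u)) (fun u => S' (I u))
    (fun u => I u = i) fun u hu => by simp [hS', Function.update_of_ne hu]
  have hsplit : (∑ u : Fin T, if I u = i then
      α (u + 1) * (‖visitedGradient ℓ α θ (fun u => S (I u)) u‖ +
        ‖visitedGradient ℓ α θ (fun u => S' (I u)) u‖) else 0) =
      (∑ u : Fin T, if I u = i then
        α (u + 1) * ‖visitedGradient ℓ α θ (fun u => S (I u)) u‖ else 0) +
      ∑ u : Fin T, if I u = i then
        α (u + 1) * ‖visitedGradient ℓ α θ (fun u => S' (I u)) u‖ else 0 := by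
    rw [← Finset.sum_add_distrib]
    refine Finset.sum_congr rfl fun u _ => ?_
    split_ifs <;> ring
  calc ℓ w z - ℓ w' z ≤ ‖gradient (fun w => ℓ w z) w‖ * ‖w - w'‖ := by
        rw [norm_sub_rev w w']; linarith
    _ ≤ _ := by
      rw [← hsplit]
      gcongr
      exact norm_gradient_sgd_le hβ hs h0 hM hα hTn hn _ z

end SgdMean

/-! ### The two bounds -/

section Main

variable {d : ℕ} {Z : Type*} [MeasurableSpace Z] (P : Measure Z) [IsProbabilityMeasure P]
  {ℓ : Param d → Z → ℝ} {α : ℕ → ℝ} {θ : Param d} {n T : ℕ} {s : Sampling} {β M : ℝ}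

theorem measurable_sgdMean (hm : ∀ w, Measurable (ℓ w))
    (hs : ∀ z, IsConvexSmooth β (fun w => ℓ w z)) :
    Measurable fun p : (Fin n → Z) × Z => sgdMean s ℓ α T θ p.1 (fun w => ℓ w p.2) :=
  (Finset.measurable_sum _ fun I _ => measurable_loss_sgd hm hs I).div_const _

theorem measurable_visitLength (hm : ∀ w, Measurable (ℓ w))
    (hs : ∀ z, IsConvexSmooth β (fun w => ℓ w z)) (i : Fin n) :
    Measurable fun S : Fin n → Z => visitLength s ℓ α T θ S i := by
  unfold visitLength
  refine Measurable.div_const (Finset.measurable_sum _ fun I _ =>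
    Finset.measurable_sum _ fun u _ => ?_) _
  split_ifs
  · have h : Measurable fun S : Fin n → Z => fun v => S (I v) :=
      measurable_pi_lambda _ fun v => measurable_pi_apply (I v)
    exact ((measurable_visitedGradient hm hs u).comp h).norm.const_mul _
  · exact measurable_const

theorem integrable_of_nonneg_of_le {Ω : Type*} [MeasurableSpace Ω] {μ : Measure Ω}
    [IsFiniteMeasure μ] {f : Ω → ℝ} (hf : Measurable f) {L : ℝ} (h0 : ∀ x, 0 ≤ f x)
    (hL : ∀ x, f x ≤ L) : Integrable f μ :=
  Integrable.of_bound hf.aestronglyMeasurable L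
    (Filter.Eventually.of_forall fun x => by rw [Real.norm_of_nonneg (h0 x)]; exact hL x)

theorem integrable_sgdMean (hm : ∀ w, Measurable (ℓ w)) (hβ : 0 < β)
    (hs : ∀ z, IsConvexSmooth β (fun w => ℓ w z)) (h0 : ∀ w z, 0 ≤ ℓ w z)
    (hM : ∀ z, ℓ θ z ≤ M) (hα : IsStepSize β α T) {Ω : Type*} [MeasurableSpace Ω] {μ : Measure Ω}
    [IsFiniteMeasure μ] {h : Ω → (Fin n → Z) × Z} (hh : Measurable h) :
    Integrable (fun ω => sgdMean s ℓ α T θ (h ω).1 (fun w => ℓ w (h ω).2)) μ := by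
  obtain ⟨L, hL0, hL⟩ := exists_loss_sgd_le hβ hs h0 hM hα
  exact integrable_of_nonneg_of_le ((measurable_sgdMean hm hs).comp hh)
    (fun ω => sgdMean_nonneg fun w => h0 w _)
    fun ω => sum_div_card_le _ hL0 fun I _ => hL _ _

theorem integral_sgdMean (hm : ∀ w, Measurable (ℓ w)) (hβ : 0 < β)
    (hs : ∀ z, IsConvexSmooth β (fun w => ℓ w z)) (h0 : ∀ w z, 0 ≤ ℓ w z)
    (hM : ∀ z, ℓ θ z ≤ M) (hα : IsStepSize β α T) (S : Fin n → Z) :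
    ∫ z, sgdMean s ℓ α T θ S (fun w => ℓ w z) ∂P = sgdMean s ℓ α T θ S (risk P ℓ) := by
  obtain ⟨L, hL0, hL⟩ := exists_loss_sgd_le hβ hs h0 hM hα
  simp only [sgdMean, risk]
  rw [integral_div, integral_finsetSum]
  intro I _
  exact integrable_of_nonneg_of_le (hm _) (fun z => h0 _ z) fun z => hL _ z

theorem integrable_sgdMean_risk (hm : ∀ w, Measurable (ℓ w)) (hβ : 0 < β)
    (hs : ∀ z, IsConvexSmooth β (fun w => ℓ w z)) (h0 : ∀ w z, 0 ≤ ℓ w z)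
    (hM : ∀ z, ℓ θ z ≤ M) (hα : IsStepSize β α T) :
    Integrable (fun S => sgdMean s ℓ α T θ S (risk P ℓ)) (Measure.pi fun _ : Fin n => P) := by
  have hR := (integrable_sgdMean (s := s) (μ := (Measure.pi fun _ : Fin n => P).prod P)
    hm hβ hs h0 hM hα measurable_id).integral_prod_left
  simpa only [id, integral_sgdMean P hm hβ hs h0 hM hα] using hR

/-- Exchanging `S i` with the fresh example turns the loss of the run on the perturbed sample at
the fresh example into the training loss at the `i`-th example. -/
theorem replaceOneGap_eq (hm : ∀ w, Measurable (ℓ w)) (hβ : 0 < β)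
    (hs : ∀ z, IsConvexSmooth β (fun w => ℓ w z)) (h0 : ∀ w z, 0 ≤ ℓ w z)
    (hM : ∀ z, ℓ θ z ≤ M) (hα : IsStepSize β α T) (i : Fin n) :
    replaceOneGap s P ℓ α n T θ i =
      ∫ S, (sgdMean s ℓ α T θ S (risk P ℓ) - sgdMean s ℓ α T θ S (fun w => ℓ w (S i)))
        ∂(Measure.pi fun _ : Fin n => P) := by
  have hτ := measurePreserving_exchange P i
  have hF := integrable_sgdMean (s := s) (μ := (Measure.pi fun _ : Fin n => P).prod P)
    hm hβ hs h0 hM hα measurable_id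
  have hH := integrable_sgdMean (s := s) (μ := Measure.pi fun _ : Fin n => P)
    hm hβ hs h0 hM hα (measurable_id.prodMk (measurable_pi_apply i))
  simp only [id] at hF hH
  have hH' : Integrable (fun p : (Fin n → Z) × Z => sgdMean s ℓ α T θ p.1 (fun w => ℓ w (p.1 i)))
      ((Measure.pi fun _ => P).prod P) := hH.comp_fst P
  have e1 : ∫ p : (Fin n → Z) × Z,
      sgdMean s ℓ α T θ (Function.update p.1 i p.2) (fun w => ℓ w p.2)
        ∂((Measure.pi fun _ => P).prod P) =
      ∫ S, sgdMean s ℓ α T θ S (fun w => ℓ w (S i)) ∂(Measure.pi fun _ : Fin n => P) := by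
    have h1 := integral_map (μ := (Measure.pi fun _ : Fin n => P).prod P)
      hτ.measurable.aemeasurable (hτ.map_eq.symm ▸ hH'.aestronglyMeasurable)
    rw [hτ.map_eq] at h1
    simp only [Function.update_self] at h1
    rw [← h1]
    simpa using integral_fun_fst (μ := Measure.pi fun _ : Fin n => P) (ν := P)
      (fun S : Fin n → Z => sgdMean s ℓ α T θ S (fun w => ℓ w (S i)))
  have hi2 := hτ.integrable_comp_of_integrable hH'
  unfold replaceOneGap
  rw [integral_sub hF, e1, integral_prod _ hF,
    integral_sub (integrable_sgdMean_risk P hm hβ hs h0 hM hα) hH]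
  · simp only [integral_sgdMean P hm hβ hs h0 hM hα]
  · simpa [Function.comp_def] using hi2

/-- The expected generalization gap is the average of the replace-one gaps. -/
theorem generalizationGap_eq (hm : ∀ w, Measurable (ℓ w)) (hβ : 0 < β)
    (hs : ∀ z, IsConvexSmooth β (fun w => ℓ w z)) (h0 : ∀ w z, 0 ≤ ℓ w z)
    (hM : ∀ z, ℓ θ z ≤ M) (hα : IsStepSize β α T) (hn : 1 ≤ n) :
    generalizationGap s P ℓ α n T θ = (∑ i, replaceOneGap s P ℓ α n T θ i) / n := by
  have hn' : (n : ℝ) ≠ 0 := by positivity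
  have hR := integrable_sgdMean_risk (n := n) (s := s) P hm hβ hs h0 hM hα
  have hH : ∀ i, Integrable (fun S => sgdMean s ℓ α T θ S (fun w => ℓ w (S i)))
      (Measure.pi fun _ : Fin n => P) := fun i =>
    integrable_sgdMean hm hβ hs h0 hM hα (measurable_id.prodMk (measurable_pi_apply i))
  simp only [replaceOneGap_eq P hm hβ hs h0 hM hα]
  have hRH : ∀ i, Integrable (fun S => sgdMean s ℓ α T θ S (risk P ℓ) -
      sgdMean s ℓ α T θ S (fun w => ℓ w (S i))) (Measure.pi fun _ : Fin n => P) :=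
    fun i => hR.sub (hH i)
  rw [← integral_finsetSum _ fun i _ => hRH i, ← integral_div]
  unfold generalizationGap
  congr 1
  ext S
  rw [sgdMean_sub, Finset.sum_sub_distrib, sub_div]
  congr 1
  · simp [hn']
  · exact sgdMean_empiricalRisk S

theorem integral_visitLength_le (hm : ∀ w, Measurable (ℓ w)) (hβ : 0 < β)
    (hs : ∀ z, IsConvexSmooth β (fun w => ℓ w z)) (h0 : ∀ w z, 0 ≤ ℓ w z)
    (hM : ∀ z, ℓ θ z ≤ M) (hM0 : 0 ≤ M) (hα : IsStepSize β α T) (hTn : T ≤ n) (hn : 1 ≤ n)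
    (i : Fin n) :
    ∫ S, visitLength s ℓ α T θ S i ∂(Measure.pi fun _ : Fin n => P) ≤ √(64 * M * n / β) / n := by
  have hsum := sum_visitLength_le (s := s) hβ hs h0 hM hM0 hα hTn
  have hint : ∀ j, Integrable (fun S => visitLength s ℓ α T θ S j)
      (Measure.pi fun _ : Fin n => P) := fun j =>
    integrable_of_nonneg_of_le (measurable_visitLength hm hs j)
      (fun S => visitLength_nonneg hα S j) fun S =>
        (Finset.single_le_sum (fun k _ => visitLength_nonneg hα S k) (Finset.mem_univ j)).trans
          (hsum S)
  have heq : ∀ j, ∫ S, visitLength s ℓ α T θ S j ∂(Measure.pi fun _ : Fin n => P) =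
      ∫ S, visitLength s ℓ α T θ S i ∂(Measure.pi fun _ : Fin n => P) := by
    intro j
    have hσ := measurePreserving_comp_perm P (Equiv.swap i j)
    have h1 := integral_map (μ := Measure.pi fun _ : Fin n => P)
      hσ.measurable.aemeasurable (hσ.map_eq.symm ▸ (hint i).aestronglyMeasurable)
    rw [hσ.map_eq] at h1
    simp only [visitLength_comp_perm, Equiv.swap_apply_left] at h1
    exact h1.symm
  have htot : ∫ S, ∑ j, visitLength s ℓ α T θ S j ∂(Measure.pi fun _ : Fin n => P) ≤
      √(64 * M * n / β) := by
    refine (integral_mono (integrable_finsetSum _ fun j _ => hint j) (integrable_const _)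
      hsum).trans ?_
    simp
  rw [integral_finsetSum _ fun j _ => hint j, Finset.sum_congr rfl fun j _ => heq j] at htot
  have hn' : (0 : ℝ) < n := by exact_mod_cast hn
  rw [le_div_iff₀ hn', mul_comm]
  simpa using htot

theorem sqrt_mul_sqrt_div_le {β M : ℝ} (hβ : 0 < β) (hM0 : 0 ≤ M) {n : ℕ} (hn : 1 ≤ n) :
    √(20 * β * M * √(n : ℝ)) * (√(64 * M * n / β) / n + √(64 * M * n / β) / n) ≤
      80 * M * √(√(1 / (n : ℝ))) := by
  have hn' : (0 : ℝ) < n := by exact_mod_cast hn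
  set q := √(√(n : ℝ)) with hq
  have hq0 : 0 < q := by positivity
  have hq2 : √(n : ℝ) = q ^ 2 := (Real.sq_sqrt (Real.sqrt_nonneg _)).symm
  have hq4 : (n : ℝ) = q ^ 4 := by
    calc (n : ℝ) = √(n : ℝ) ^ 2 := (Real.sq_sqrt hn'.le).symm
      _ = q ^ 4 := by rw [hq2]; ring
  have hinv : √(√(1 / (n : ℝ))) = 1 / q := by
    rw [one_div, Real.sqrt_inv, Real.sqrt_inv, one_div]
  have hGB : √(20 * β * M * √(n : ℝ)) * √(64 * M * n / β) ≤
      40 * M * q ^ 3 := by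
    rw [← Real.sqrt_mul (by positivity)]
    refine Real.sqrt_le_iff.2 ⟨by positivity, ?_⟩
    rw [hq2, hq4]
    have : 20 * β * M * q ^ 2 * (64 * M * q ^ 4 / β) = 1280 * (M ^ 2 * q ^ 6) := by
      field_simp
      ring
    rw [this]
    have : 0 ≤ M ^ 2 * q ^ 6 := by positivity
    nlinarith
  calc √(20 * β * M * √(n : ℝ)) * (√(64 * M * n / β) / n + √(64 * M * n / β) / n) =
        2 * (√(20 * β * M * √(n : ℝ)) * √(64 * M * n / β)) / q ^ 4 := by rw [← hq4]; ring
    _ ≤ 2 * (40 * M * q ^ 3) / q ^ 4 := by gcongr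
    _ = 80 * M * √(√(1 / (n : ℝ))) := by
      rw [hinv]
      field_simp
      ring

/-- The replace-one gap decays at least like `n ^ (-1 / 4)`: the gradients at the output are at most
of order `n ^ (1 / 4)`, and a single example contributes an expected step length of order at most
`n ^ (-1 / 2)`. -/
theorem replaceOneGap_le (hm : ∀ w, Measurable (ℓ w)) (hβ : 0 < β)
    (hs : ∀ z, IsConvexSmooth β (fun w => ℓ w z)) (h0 : ∀ w z, 0 ≤ ℓ w z)
    (hM : ∀ z, ℓ θ z ≤ M) (hM0 : 0 ≤ M) (hα : IsStepSize β α T) (hTn : T ≤ n) (hn : 1 ≤ n)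
    (i : Fin n) :
    replaceOneGap s P ℓ α n T θ i ≤ 80 * M * √(√(1 / (n : ℝ))) := by
  have hτ := measurePreserving_exchange P i
  set G := √(20 * β * M * √(n : ℝ))
  set B := √(64 * M * n / β)
  have hV : Integrable (fun S => visitLength s ℓ α T θ S i) (Measure.pi fun _ : Fin n => P) :=
    integrable_of_nonneg_of_le (measurable_visitLength hm hs i)
      (fun S => visitLength_nonneg hα S i) fun S =>
        (Finset.single_le_sum (fun k _ => visitLength_nonneg hα S k) (Finset.mem_univ i)).trans
          (sum_visitLength_le hβ hs h0 hM hM0 hα hTn S)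
  have hV1 : Integrable (fun p : (Fin n → Z) × Z => visitLength s ℓ α T θ p.1 i)
      ((Measure.pi fun _ => P).prod P) := hV.comp_fst P
  have hV2 : Integrable
      (fun p : (Fin n → Z) × Z => visitLength s ℓ α T θ (Function.update p.1 i p.2) i)
      ((Measure.pi fun _ => P).prod P) := by
    have := hτ.integrable_comp_of_integrable hV1
    simpa only [Function.comp_def] using this
  have e1 : ∫ p : (Fin n → Z) × Z, visitLength s ℓ α T θ p.1 i ∂((Measure.pi fun _ => P).prod P) =
      ∫ S, visitLength s ℓ α T θ S i ∂(Measure.pi fun _ : Fin n => P) := by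
    simpa using integral_fun_fst (μ := Measure.pi fun _ : Fin n => P) (ν := P)
      (fun S : Fin n → Z => visitLength s ℓ α T θ S i)
  have e2 : ∫ p : (Fin n → Z) × Z, visitLength s ℓ α T θ (Function.update p.1 i p.2) i
      ∂((Measure.pi fun _ => P).prod P) =
      ∫ S, visitLength s ℓ α T θ S i ∂(Measure.pi fun _ : Fin n => P) := by
    have h1 := integral_map (μ := (Measure.pi fun _ : Fin n => P).prod P)
      hτ.measurable.aemeasurable (hτ.map_eq.symm ▸ hV1.aestronglyMeasurable)
    rw [hτ.map_eq] at h1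
    rw [← e1, h1]
  have hint : Integrable (fun p : (Fin n → Z) × Z =>
      sgdMean s ℓ α T θ p.1 (fun w => ℓ w p.2) -
        sgdMean s ℓ α T θ (Function.update p.1 i p.2) (fun w => ℓ w p.2))
      ((Measure.pi fun _ => P).prod P) := by
    have h1 := integrable_sgdMean (s := s) (μ := (Measure.pi fun _ : Fin n => P).prod P)
      hm hβ hs h0 hM hα measurable_id
    have h2 := integrable_sgdMean (s := s) (μ := (Measure.pi fun _ : Fin n => P).prod P)
      (h := fun p => (Function.update p.1 i p.2, p.2))
      hm hβ hs h0 hM hα ((measurable_fst.comp hτ.measurable).prodMk measurable_snd)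
    exact h1.sub h2
  have hV0 := integral_visitLength_le (s := s) P hm hβ hs h0 hM hM0 hα hTn hn i
  have hmono : replaceOneGap s P ℓ α n T θ i ≤ G * (B / n + B / n) := by
    calc replaceOneGap s P ℓ α n T θ i ≤ ∫ p : (Fin n → Z) × Z, G *
            (visitLength s ℓ α T θ p.1 i + visitLength s ℓ α T θ (Function.update p.1 i p.2) i)
            ∂((Measure.pi fun _ => P).prod P) :=
          integral_mono hint ((hV1.add hV2).const_mul G)
            fun p => sgdMean_sub_update_le hβ hs h0 hM hα hTn hn p.1 i p.2
      _ ≤ G * (B / n + B / n) := by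
          rw [integral_const_mul, integral_add hV1 hV2, e1, e2]
          gcongr
  exact hmono.trans (sqrt_mul_sqrt_div_le hβ hM0 hn)

end Main

end HSML

end

theorem theorem1 (M : ℝ) :
    ∃ C : ℝ, ∀ (d K n T : ℕ) (Z : Type*) [MeasurableSpace Z]
      (P : MeasureTheory.Measure Z) [MeasureTheory.IsProbabilityMeasure P]
      (ℓ : HSML.Param d → Z → ℝ) (β c : ℝ) (α : ℕ → ℝ) (s : HSML.Sampling)
      (B : Fin K → Matrix (Fin d) (Fin d) ℝ) (θ₀ : HSML.Param d),
      1 ≤ n → T ≤ n →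
      -- the loss is measurable in the example, nonnegative, and convex and smooth in the parameter
      (∀ θ, Measurable (ℓ θ)) →
      (∀ θ z, 0 ≤ ℓ θ z) →
      (∀ z, ConvexOn ℝ Set.univ (fun θ => ℓ θ z)) →
      (∀ z, Differentiable ℝ (fun θ => ℓ θ z)) →
      (∀ z θ θ', ‖gradient (fun w => ℓ w z) θ - gradient (fun w => ℓ w z) θ'‖ ≤ β * ‖θ - θ'‖) →
      -- the loss of the initialization is bounded
      (∀ z, ℓ (HSML.clusterInit B θ₀) z ≤ M) →
      -- the step sizes
      0 < β → 0 < c → c ≤ 1 / β →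
      (∀ u : ℕ, 1 ≤ u → u ≤ T → 0 ≤ α u ∧ α u ≤ c / Real.sqrt u) →
      HSML.generalizationGap s P ℓ α n T (HSML.clusterInit B θ₀) ≤
          HSML.stabilityConstant s P ℓ α n T (HSML.clusterInit B θ₀) ∧
        ∀ D : Fin n → Z,
          HSML.stabilityConstant s P ℓ α n T (HSML.clusterInit B θ₀) ≤
            C * Real.sqrt
              (HSML.empiricalRisk ℓ D (HSML.clusterInit B θ₀) + Real.sqrt (1 / (n : ℝ))) := by
  refine ⟨80 * M, ?_⟩
  intro d K n T Z _ P _ ℓ β c α s B θ₀ hn hTn hm h0 hconv hdiff hlip hM hβ hc hcβ hstep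
  have hs : ∀ z, HSML.IsConvexSmooth β (fun w => ℓ w z) := fun z =>
    ⟨hconv z, hdiff z, hlip z⟩
  have hα : HSML.IsStepSize β α T := by
    intro u hu
    obtain ⟨h1, h2⟩ := hstep (u + 1) (Nat.le_add_left 1 u) hu
    refine ⟨h1, ?_⟩
    calc β * α (u + 1) ≤ β * (1 / β / √((u + 1 : ℕ) : ℝ)) := by
          gcongr
          exact h2.trans (by gcongr)
      _ = 1 / √((u + 1 : ℕ) : ℝ) := by field_simp
  have : Nonempty Z := MeasureTheory.nonempty_of_isProbabilityMeasure P
  have hM0 : 0 ≤ M := (h0 _ (Classical.arbitrary Z)).trans (hM _)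
  have : Nonempty (Fin n) := ⟨⟨0, hn⟩⟩
  have hn' : (0 : ℝ) < n := by exact_mod_cast hn
  constructor
  · rw [HSML.generalizationGap_eq P hm hβ hs h0 hM hα hn, div_le_iff₀ hn']
    have hstab := (HSML.isLeast_stabilityConstant s P ℓ α n T hn (HSML.clusterInit B θ₀)).1
    refine (Finset.sum_le_sum fun i _ => hstab i).trans_eq ?_
    simp [mul_comm]
  · intro D
    refine ciSup_le fun i =>
      (HSML.replaceOneGap_le P hm hβ hs h0 hM hM0 hα hTn hn i).trans ?_
    have hemp : 0 ≤ HSML.empiricalRisk ℓ D (HSML.clusterInit B θ₀) :=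
      div_nonneg (Finset.sum_nonneg fun j _ => h0 _ _) hn'.le
    gcongr
    linarith
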